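/- **Setting.** Let $\vartheta$ (the claim) and $\rho$ (the pricing kernel) be real random variables on a probability space, with $\rho>0$ a.s., $\mathbb E[\rho]<\infty$ and $\operatorname{ess\,inf}\vartheta>-\infty$. Put $a=\min\{0,\operatorname{ess\,inf}\vartheta\}$, and let $u$ be continuous on $[a,\infty)$ and continuously differentiable on $(a,\infty)$, with $u'$ strictly decreasing and $u'(y)\to0$ as $y\to\infty$; assume $\mathbb E[u(\vartheta)]<\infty$. For a random variable $Y$ let $Q_Y(t)=\inf\{z\in\mathbb R: \mathbb P(Y\le z)>t\}$, $t\in(0,1)$, be its quantile function, and let $\mathscr Q$ be the set of quantiles of nonnegative random variables, that is, of right-continuous nondecreasing functions $Q:(0,1)\to[0,\infty)$. For $Q\in\mathscr Q$ and $\lambda>0$ put $$J_0(Q)=\int_0^1 u\big(Q(t)+Q_\vartheta(t)\big)\,dt,\qquad J_\lambda(Q)=\int_0^1\big[u\big(Q(t)+Q_\vartheta(t)\big)-\lambda Q(t)Q_\rho(1-t)\big]\,dt,$$ as integrals with values in $[-\infty,\infty]$, where $\int f=\int f^+-\int f^-$ and an indeterminate $\infty-\infty$ counts as $-\infty$. For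 $x>0$ let $$V_0(x)=\sup\Big\{J_0(Q): Q\in\mathscr Q,\ \int_0^1Q(t)Q_\rho(1-t)\,dt=x\Big\}\qquad(1)$$ be the optimal value of the budget-constrained quantile problem, and let $$V_\lambda=\sup_{Q\in\mathscr Q}J_\lambda(Q).\qquad(2)$$ Assume that the constrained problem is well-posed: $V_0(y)<\infty$ for all $y>0$. **Lemma.** Let $x>0$. A quantile $\overline Q$ is an optimal solution of (1) if and only if there is a constant $\lambda>0$ such that $$\int_0^1\overline Q(t)Q_\rho(1-t)\,dt=x\qquad(3)$$ and $\overline Q$ is an optimal solution of (2). Moreover, for every $\lambda>0$ and $\overline Q$ such that (3) holds and $\overline Q$ is an optimal solution of (2), $$V_0(x)=V_\lambda+\lambda x .$$ -/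

import Mathlib

open MeasureTheory Set Filter Topology

noncomputable section

namespace RobustUtility

/-- The (right-continuous) quantile function of a random variable `Y` under `P`:
`Q_Y(t) = inf {z : F_Y(z) > t}`, to be used for `t ∈ (0,1)`. -/
def quantile {Ω : Type*} [MeasurableSpace Ω] (P : Measure Ω) (Y : Ω → ℝ) (t : ℝ) : ℝ :=
  sInf {z : ℝ | t < P.real {ω | Y ω ≤ z}}

/-- The set of quantiles of nonnegative random variables: the functions `(0,1) → [0,∞)` that are
right-continuous and increasing. Only the values on `(0,1)` matter. -/
def nonnegQuantiles : Set (ℝ → ℝ) :=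
  {Q | MonotoneOn Q (Ioo 0 1) ∧
    (∀ t ∈ Ioo (0 : ℝ) 1, ContinuousWithinAt Q (Ici t) t) ∧
    ∀ t ∈ Ioo (0 : ℝ) 1, 0 ≤ Q t}

/-- The extended Lebesgue integral over `(0,1)`, `∫ f⁺ - ∫ f⁻`, with values in `[-∞, ∞]`
(an indeterminate difference `∞ - ∞` counts as `-∞`, as `EReal` subtraction has it). -/
def extIntegral (f : ℝ → ℝ) : EReal :=
  ((∫⁻ t in Ioo (0 : ℝ) 1, ENNReal.ofReal (f t) : ENNReal) : EReal)
    - ((∫⁻ t in Ioo (0 : ℝ) 1, ENNReal.ofReal (-f t) : ENNReal) : EReal)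

/-- The cost `∫₀¹ Q(t) Q_ρ(1-t) dt` of a quantile `Q`; `qρ` stands for `Q_ρ`. -/
def cost (qρ Q : ℝ → ℝ) : EReal :=
  extIntegral fun t => Q t * qρ (1 - t)

/-- The robust preference `J₀(Q) = ∫₀¹ u(Q(t) + Q_ϑ(t)) dt`; `qϑ` stands for `Q_ϑ`. -/
def J₀ (u qϑ Q : ℝ → ℝ) : EReal :=
  extIntegral fun t => u (Q t + qϑ t)

/-- The Lagrangian `J_λ(Q) = ∫₀¹ [u(Q(t) + Q_ϑ(t)) - λ Q(t) Q_ρ(1-t)] dt`. -/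
def Jlag (u qϑ qρ : ℝ → ℝ) (lam : ℝ) (Q : ℝ → ℝ) : EReal :=
  extIntegral fun t => u (Q t + qϑ t) - lam * Q t * qρ (1 - t)

/-- The quantiles that meet the budget constraint with equality. -/
def feasible (qρ : ℝ → ℝ) (x : ℝ) : Set (ℝ → ℝ) :=
  {Q | Q ∈ nonnegQuantiles ∧ cost qρ Q = (x : EReal)}

/-- The value function `V₀`: the optimal value of the budget-constrained problem. -/
def V₀ (u qϑ qρ : ℝ → ℝ) (x : ℝ) : EReal :=
  ⨆ Q ∈ feasible qρ x, J₀ u qϑ Q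

/-- The optimal value `V_λ` of the unconstrained problem. -/
def Vlag (u qϑ qρ : ℝ → ℝ) (lam : ℝ) : EReal :=
  ⨆ Q ∈ nonnegQuantiles, Jlag u qϑ qρ lam Q

/-- `Q` is an optimal solution of the budget-constrained problem. -/
def IsOptimalConstrained (u qϑ qρ : ℝ → ℝ) (x : ℝ) (Q : ℝ → ℝ) : Prop :=
  Q ∈ feasible qρ x ∧ ∀ Q' ∈ feasible qρ x, J₀ u qϑ Q' ≤ J₀ u qϑ Q

/-- `Q` is an optimal solution of the unconstrained problem with multiplier `λ`. -/
def IsOptimalLagrangian (u qϑ qρ : ℝ → ℝ) (lam : ℝ) (Q : ℝ → ℝ) : Prop :=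
  Q ∈ nonnegQuantiles ∧ ∀ Q' ∈ nonnegQuantiles, Jlag u qϑ qρ lam Q' ≤ Jlag u qϑ qρ lam Q

/-- The utility function on `[a, ∞)`: continuous there, continuously differentiable on `(a, ∞)`,
with `u'` strictly decreasing to `0` at infinity. -/
structure IsUtility (u : ℝ → ℝ) (a : ℝ) : Prop where
  continuousOn : ContinuousOn u (Ici a)
  contDiffOn : ContDiffOn ℝ 1 u (Ioi a)
  deriv_strictAntiOn : StrictAntiOn (deriv u) (Ioi a)
  deriv_tendsto : Tendsto (deriv u) atTop (𝓝 0)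

end RobustUtility

end

/-! Utility is concave in `Q` and cost is linear, so this is Lagrangian duality in one dimension. On
the budget set the two objectives differ by the constant `lam * x`; hence a Lagrangian optimum that
meets the budget is a constrained optimum, and the value identity follows. Conversely, an optimal
`Q` gives a topmost point above `x` among the (cost, utility) pairs of finite-cost quantiles. Costs
lie on both sides of `x` (take `0` and `Q + 1`), so a supporting line exists there; its slope is the
multiplier (`exists_multiplier`), positive because `Q + 1` has strictly larger utility. Finiteness
of `V₀` makes these utilities real numbers (`integrableOn_utility`). A quantile of infinite cost may
still have a Lagrangian above `-∞`, since that is a single integral. Truncation and Fatou's lemma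
carry the bound over to it (`Jlag_le_of_forall_finiteCost`). -/

namespace RobustUtility

/-! ### Quantile functions and the law they carry -/

section Quantile

variable {Ω : Type*} [MeasurableSpace Ω] {P : Measure Ω} [IsProbabilityMeasure P] {Y : Ω → ℝ}

theorem measureReal_setOf_le_eq_cdf (hY : Measurable Y) (z : ℝ) :
    P.real {ω | Y ω ≤ z} = ProbabilityTheory.cdf (P.map Y) z := by
  have := Measure.isProbabilityMeasure_map (μ := P) hY.aemeasurable
  rw [ProbabilityTheory.cdf_eq_real, map_measureReal_apply hY measurableSet_Iic]
  rfl

theorem quantile_set_nonempty (hY : Measurable Y) {t : ℝ} (ht : t < 1) :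
    {z : ℝ | t < P.real {ω | Y ω ≤ z}}.Nonempty := by
  obtain ⟨z, hz⟩ := ((ProbabilityTheory.tendsto_cdf_atTop (P.map Y)).eventually
    (lt_mem_nhds ht)).exists
  exact ⟨z, by simpa [measureReal_setOf_le_eq_cdf hY] using hz⟩

theorem quantile_set_bddBelow (hY : Measurable Y) {t : ℝ} (ht : 0 < t) :
    BddBelow {z : ℝ | t < P.real {ω | Y ω ≤ z}} := by
  obtain ⟨z, hz⟩ := ((ProbabilityTheory.tendsto_cdf_atBot (P.map Y)).eventually
    (gt_mem_nhds ht)).exists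
  refine ⟨z, fun w hw => ?_⟩
  simp only [measureReal_setOf_le_eq_cdf hY, mem_ofPred_eq] at hw
  by_contra! h
  exact absurd (ProbabilityTheory.monotone_cdf (P.map Y) h.le) (not_le.2 (hz.trans hw))

theorem quantile_monotoneOn (hY : Measurable Y) : MonotoneOn (quantile P Y) (Ioo 0 1) :=
  fun _ hs _ ht hst => csInf_le_csInf (quantile_set_bddBelow hY hs.1)
    (quantile_set_nonempty hY ht.2) fun _ hz => hst.trans_lt hz

theorem quantile_le_of_lt (hY : Measurable Y) {t z : ℝ} (ht : 0 < t)
    (h : t < P.real {ω | Y ω ≤ z}) : quantile P Y t ≤ z :=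
  csInf_le (quantile_set_bddBelow hY ht) h

/-- Every point right of `z` has distribution function above `t`; right-continuity passes this to
`z`, at the price of a weak inequality. -/
theorem le_of_quantile_le (hY : Measurable Y) {t z : ℝ} (ht : t < 1)
    (h : quantile P Y t ≤ z) : t ≤ P.real {ω | Y ω ≤ z} := by
  have key : ∀ w > z, t < ProbabilityTheory.cdf (P.map Y) w := by
    intro w hw
    obtain ⟨v, hv, hvw⟩ := exists_lt_of_csInf_lt (quantile_set_nonempty hY ht) (h.trans_lt hw)
    simp only [measureReal_setOf_le_eq_cdf hY, mem_ofPred_eq] at hv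
    exact hv.trans_le (ProbabilityTheory.monotone_cdf _ hvw.le)
  rw [measureReal_setOf_le_eq_cdf hY]
  have hc := ((ProbabilityTheory.cdf (P.map Y)).right_continuous z).mono_left
    (nhdsWithin_mono z Ioi_subset_Ici_self)
  exact ge_of_tendsto hc (by filter_upwards [self_mem_nhdsWithin] with w hw using (key w hw).le)

theorem le_quantile (hY : Measurable Y) {c : ℝ} (hc : ∀ᵐ ω ∂P, c ≤ Y ω) {t : ℝ}
    (ht : t ∈ Ioo (0 : ℝ) 1) : c ≤ quantile P Y t := by
  refine le_csInf (quantile_set_nonempty hY ht.2) fun z hz => ?_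
  by_contra! hzc
  have : P.real {ω | Y ω ≤ z} = 0 := by
    rw [measureReal_def, measure_eq_zero_iff_ae_notMem.2, ENNReal.toReal_zero]
    filter_upwards [hc] with ω h1 h2
    exact absurd (h1.trans h2) (not_le.2 hzc)
  exact absurd hz (by simp [this, ht.1.le])

theorem quantile_pos (hY : Measurable Y) (hpos : ∀ᵐ ω ∂P, 0 < Y ω) {t : ℝ}
    (ht : t ∈ Ioo (0 : ℝ) 1) : 0 < quantile P Y t := by
  by_contra! h
  have h1 := le_of_quantile_le hY ht.2 h
  have : P.real {ω | Y ω ≤ 0} = 0 := by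
    rw [measureReal_def, measure_eq_zero_iff_ae_notMem.2, ENNReal.toReal_zero]
    filter_upwards [hpos] with ω h1 h2
    exact absurd h1 (not_lt.2 h2)
  linarith [ht.1]

theorem aemeasurable_quantile (hY : Measurable Y) :
    AEMeasurable (quantile P Y) (volume.restrict (Ioo 0 1)) :=
  aemeasurable_restrict_of_monotoneOn measurableSet_Ioo (quantile_monotoneOn hY)

/-- Under the uniform law on `(0,1)`, the quantile function of `Y` has the law of `Y`. -/
theorem map_quantile (hY : Measurable Y) :
    (volume.restrict (Ioo (0 : ℝ) 1)).map (quantile P Y) = P.map Y := by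
  have : IsProbabilityMeasure (volume.restrict (Ioo (0 : ℝ) 1)) := ⟨by simp⟩
  have := Measure.isProbabilityMeasure_map (μ := volume.restrict (Ioo (0 : ℝ) 1))
    (aemeasurable_quantile (P := P) hY)
  refine Measure.ext_of_Iic _ _ fun z => ?_
  rw [Measure.map_apply_of_aemeasurable (aemeasurable_quantile hY) measurableSet_Iic,
    Measure.map_apply hY measurableSet_Iic, Measure.restrict_apply' measurableSet_Ioo]
  set F := P.real {ω | Y ω ≤ z} with hF
  have hPF : P (Y ⁻¹' Iic z) = ENNReal.ofReal F := by
    simp [hF, measureReal_def, preimage, ENNReal.ofReal_toReal]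
  have hF1 : F ≤ 1 := measureReal_le_one
  rw [hPF]
  -- The sublevel set of the quantile lies between `(0, F)` and `(0, F]`, which have the same
  -- length.
  apply le_antisymm
  · calc volume (quantile P Y ⁻¹' Iic z ∩ Ioo 0 1) ≤ volume (Ioc 0 F) :=
        measure_mono fun t ht => show 0 < t ∧ t ≤ F from
          ⟨ht.2.1, le_of_quantile_le hY ht.2.2 ht.1⟩
      _ = ENNReal.ofReal F := by simp
  · calc ENNReal.ofReal F = volume (Ioo 0 F) := by simp
      _ ≤ _ := measure_mono fun t ht => show _ ∧ _ from ⟨quantile_le_of_lt hY ht.1 ht.2, ht.1, ht.2.trans_le hF1⟩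

theorem integrableOn_comp_quantile (hY : Measurable Y) {f : ℝ → ℝ}
    (hf : AEStronglyMeasurable f (P.map Y)) (hint : Integrable (fun ω => f (Y ω)) P) :
    IntegrableOn (fun t => f (quantile P Y t)) (Ioo 0 1) := by
  have h1 : Integrable f (P.map Y) := (integrable_map_measure hf hY.aemeasurable).2 hint
  rw [← map_quantile hY] at h1
  exact h1.comp_aemeasurable (aemeasurable_quantile hY)

end Quantile

theorem IntegrableOn.comp_one_sub {f : ℝ → ℝ} (hf : IntegrableOn f (Ioo 0 1)) :
    IntegrableOn (fun t => f (1 - t)) (Ioo 0 1) := by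
  have h := (intervalIntegrable_iff_integrableOn_Ioo_of_le (μ := volume) zero_le_one).2 hf
  simpa [intervalIntegrable_iff_integrableOn_Ioo_of_le] using (h.comp_sub_left 1).symm

/-! ### Extended integrals and integrability -/

section ExtIntegral

variable {f : ℝ → ℝ}

theorem extIntegral_eq_integral (hf : IntegrableOn f (Ioo 0 1)) :
    extIntegral f = ((∫ t in Ioo (0 : ℝ) 1, f t : ℝ) : EReal) := by
  have h1 : ∫⁻ t in Ioo (0 : ℝ) 1, ENNReal.ofReal (f t) ≠ ⊤ := hf.lintegral_lt_top.ne
  have h2 : ∫⁻ t in Ioo (0 : ℝ) 1, ENNReal.ofReal (-f t) ≠ ⊤ := hf.neg.lintegral_lt_top.ne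
  rw [integral_eq_lintegral_pos_part_sub_lintegral_neg_part hf, extIntegral, EReal.coe_sub,
    EReal.coe_ennreal_toReal h1, EReal.coe_ennreal_toReal h2]

/-- In `EReal`, subtracting `⊤` gives `⊥`, even from `⊤`. -/
theorem lintegral_neg_ne_top_of_extIntegral_ne_bot (h : extIntegral f ≠ ⊥) :
    ∫⁻ t in Ioo (0 : ℝ) 1, ENNReal.ofReal (-f t) ≠ ⊤ := by
  intro h2
  exact h (by simp [extIntegral, h2])

theorem lintegral_pos_ne_top_of_extIntegral_ne_top (h : extIntegral f ≠ ⊤)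
    (h2 : ∫⁻ t in Ioo (0 : ℝ) 1, ENNReal.ofReal (-f t) ≠ ⊤) :
    ∫⁻ t in Ioo (0 : ℝ) 1, ENNReal.ofReal (f t) ≠ ⊤ := by
  intro h1
  refine h ?_
  rw [extIntegral, h1, ← EReal.coe_ennreal_toReal h2]
  exact EReal.top_sub_coe _

theorem integrableOn_of_lintegral_ne_top
    (hf : AEMeasurable f (volume.restrict (Ioo 0 1)))
    (h1 : ∫⁻ t in Ioo (0 : ℝ) 1, ENNReal.ofReal (f t) ≠ ⊤)
    (h2 : ∫⁻ t in Ioo (0 : ℝ) 1, ENNReal.ofReal (-f t) ≠ ⊤) :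
    IntegrableOn f (Ioo 0 1) := by
  refine ⟨hf.aestronglyMeasurable, ?_⟩
  rw [hasFiniteIntegral_iff_enorm]
  have : ∀ t, ‖f t‖ₑ = ENNReal.ofReal (f t) + ENNReal.ofReal (-f t) := by
    intro t
    rw [Real.enorm_eq_ofReal_abs]
    rcases le_total 0 (f t) with h | h
    · simp [abs_of_nonneg h, ENNReal.ofReal_of_nonpos (neg_nonpos.2 h)]
    · simp [abs_of_nonpos h, ENNReal.ofReal_of_nonpos h]
  simp_rw [this]
  rw [lintegral_add_left' hf.ennreal_ofReal]
  exact ENNReal.add_lt_top.2 ⟨h1.lt_top, h2.lt_top⟩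

theorem integrableOn_of_extIntegral_eq_coe {c : ℝ}
    (hf : AEMeasurable f (volume.restrict (Ioo 0 1))) (h : extIntegral f = (c : EReal)) :
    IntegrableOn f (Ioo 0 1) := by
  have h2 := lintegral_neg_ne_top_of_extIntegral_ne_bot (f := f) (by simp [h])
  exact integrableOn_of_lintegral_ne_top hf
    (lintegral_pos_ne_top_of_extIntegral_ne_top (by simp [h]) h2) h2

end ExtIntegral

/-! ### Monotonicity and concavity of the utility -/

section Utility

variable {u : ℝ → ℝ} {a : ℝ}

/-- A strictly decreasing function stays strictly above its limit at infinity. -/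
theorem IsUtility.deriv_pos (hu : IsUtility u a) {y : ℝ} (hy : a < y) : 0 < deriv u y := by
  have h1 : deriv u (y + 1) < deriv u y :=
    hu.deriv_strictAntiOn hy (show a < y + 1 by linarith) (by linarith)
  have h2 : 0 ≤ deriv u (y + 1) := le_of_tendsto hu.deriv_tendsto (by
    filter_upwards [eventually_gt_atTop (y + 1)] with z hz
    exact (hu.deriv_strictAntiOn (show a < y + 1 by linarith) (show a < z by linarith) hz).le)
  linarith

theorem IsUtility.strictMonoOn (hu : IsUtility u a) : StrictMonoOn u (Ici a) :=
  strictMonoOn_of_deriv_pos (convex_Ici a) hu.continuousOn fun _ hy =>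
    hu.deriv_pos (by simpa using hy)

theorem IsUtility.concaveOn (hu : IsUtility u a) : ConcaveOn ℝ (Ici a) u :=
  (StrictAntiOn.strictConcaveOn_of_deriv (convex_Ici a) hu.continuousOn
    (by simpa using hu.deriv_strictAntiOn)).concaveOn

end Utility
end RobustUtility

/-! ### Quantiles of finite cost in a market on the unit interval -/

noncomputable section
namespace RobustUtility

/-- The utility `u`, the quantile `qϑ` of the claim and the quantile `qρ` of the pricing kernel
of a portfolio choice problem on `(0,1)`. -/
structure IsMarket (u qϑ qρ : ℝ → ℝ) (a : ℝ) : Prop where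
  utility : IsUtility u a
  claim_mono : MonotoneOn qϑ (Ioo 0 1)
  claim_ge : ∀ t ∈ Ioo (0 : ℝ) 1, a ≤ qϑ t
  utility_claim_int : IntegrableOn (fun t => u (qϑ t)) (Ioo 0 1)
  kernel_pos : ∀ t ∈ Ioo (0 : ℝ) 1, 0 < qρ (1 - t)
  kernel_int : IntegrableOn (fun t => qρ (1 - t)) (Ioo 0 1)

/-- The quantiles of finite cost. -/
def finiteCost (qρ : ℝ → ℝ) : Set (ℝ → ℝ) :=
  {Q | Q ∈ nonnegQuantiles ∧ IntegrableOn (fun t => Q t * qρ (1 - t)) (Ioo 0 1)}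

/-- The cost of a quantile as a real number. -/
def realCost (qρ Q : ℝ → ℝ) : ℝ := ∫ t in Ioo (0 : ℝ) 1, Q t * qρ (1 - t)

/-- The utility of a quantile as a real number. -/
def realUtility (u qϑ Q : ℝ → ℝ) : ℝ := ∫ t in Ioo (0 : ℝ) 1, u (Q t + qϑ t)

variable {u qϑ qρ : ℝ → ℝ} {a : ℝ}

theorem const_mem_nonnegQuantiles {c : ℝ} (hc : 0 ≤ c) :
    (fun _ => c) ∈ nonnegQuantiles :=
  ⟨monotoneOn_const, fun _ _ => continuousWithinAt_const, fun _ _ => hc⟩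

theorem nonnegQuantiles.add {Q R : ℝ → ℝ} (hQ : Q ∈ nonnegQuantiles) (hR : R ∈ nonnegQuantiles) :
    (fun t => Q t + R t) ∈ nonnegQuantiles :=
  ⟨hQ.1.add hR.1, fun t ht => (hQ.2.1 t ht).add (hR.2.1 t ht),
    fun t ht => add_nonneg (hQ.2.2 t ht) (hR.2.2 t ht)⟩

theorem nonnegQuantiles.const_mul {Q : ℝ → ℝ} (hQ : Q ∈ nonnegQuantiles) {c : ℝ} (hc : 0 ≤ c) :
    (fun t => c * Q t) ∈ nonnegQuantiles :=
  ⟨fun _ hs _ ht hst => mul_le_mul_of_nonneg_left (hQ.1 hs ht hst) hc,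
    fun t ht => (hQ.2.1 t ht).const_mul c, fun t ht => mul_nonneg hc (hQ.2.2 t ht)⟩

theorem nonnegQuantiles.min_const {Q : ℝ → ℝ} (hQ : Q ∈ nonnegQuantiles) {c : ℝ} (hc : 0 ≤ c) :
    (fun t => min (Q t) c) ∈ nonnegQuantiles :=
  ⟨fun _ hs _ ht hst => min_le_min_right c (hQ.1 hs ht hst),
    fun t ht => (hQ.2.1 t ht).min continuousWithinAt_const,
    fun t ht => le_min (hQ.2.2 t ht) hc⟩

theorem aemeasurable_of_mem_nonnegQuantiles {Q : ℝ → ℝ} (hQ : Q ∈ nonnegQuantiles) :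
    AEMeasurable Q (volume.restrict (Ioo 0 1)) :=
  aemeasurable_restrict_of_monotoneOn measurableSet_Ioo hQ.1

theorem finiteCost.add {Q R : ℝ → ℝ} (hQ : Q ∈ finiteCost qρ) (hR : R ∈ finiteCost qρ) :
    (fun t => Q t + R t) ∈ finiteCost qρ :=
  ⟨nonnegQuantiles.add hQ.1 hR.1, by simpa only [add_mul] using! hQ.2.add hR.2⟩

theorem finiteCost.const_mul {Q : ℝ → ℝ} (hQ : Q ∈ finiteCost qρ) {c : ℝ} (hc : 0 ≤ c) :
    (fun t => c * Q t) ∈ finiteCost qρ :=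
  ⟨nonnegQuantiles.const_mul hQ.1 hc, by simpa only [mul_assoc] using! hQ.2.const_mul c⟩

theorem realCost_add {Q R : ℝ → ℝ} (hQ : Q ∈ finiteCost qρ) (hR : R ∈ finiteCost qρ) :
    realCost qρ (fun t => Q t + R t) = realCost qρ Q + realCost qρ R := by
  simp only [realCost, add_mul]
  exact integral_add hQ.2 hR.2

theorem realCost_const_mul (c : ℝ) (Q : ℝ → ℝ) :
    realCost qρ (fun t => c * Q t) = c * realCost qρ Q := by
  simp only [realCost, mul_assoc]
  exact integral_const_mul _ _

theorem cost_eq_realCost {Q : ℝ → ℝ} (hQ : Q ∈ finiteCost qρ) :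
    cost qρ Q = (realCost qρ Q : EReal) := extIntegral_eq_integral hQ.2

theorem integrableOn_Ioo_of_le {f g h : ℝ → ℝ}
    (hg : AEMeasurable g (volume.restrict (Ioo 0 1)))
    (hf : IntegrableOn f (Ioo 0 1)) (hh : IntegrableOn h (Ioo 0 1))
    (h1 : ∀ t ∈ Ioo (0 : ℝ) 1, f t ≤ g t) (h2 : ∀ t ∈ Ioo (0 : ℝ) 1, g t ≤ h t) :
    IntegrableOn g (Ioo 0 1) :=
  integrable_of_le_of_le hg.aestronglyMeasurable
    ((ae_restrict_iff' measurableSet_Ioo).2 (ae_of_all _ h1))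
    ((ae_restrict_iff' measurableSet_Ioo).2 (ae_of_all _ h2)) hf hh

theorem setIntegral_Ioo_pos {f : ℝ → ℝ} (hf : IntegrableOn f (Ioo 0 1))
    (hpos : ∀ t ∈ Ioo (0 : ℝ) 1, 0 < f t) : 0 < ∫ t in Ioo (0 : ℝ) 1, f t := by
  rw [setIntegral_pos_iff_support_of_nonneg_ae
    ((ae_restrict_iff' measurableSet_Ioo).2 (ae_of_all _ fun t ht => (hpos t ht).le)) hf]
  have : Function.support f ∩ Ioo 0 1 = Ioo 0 1 :=
    inter_eq_right.2 fun t ht => (hpos t ht).ne'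
  simp [this]

namespace IsMarket

variable (h : IsMarket u qϑ qρ a)
include h

theorem const_mem_finiteCost {c : ℝ} (hc : 0 ≤ c) : (fun _ => c) ∈ finiteCost qρ :=
  ⟨const_mem_nonnegQuantiles hc, h.kernel_int.const_mul c⟩

theorem realCost_const_pos {c : ℝ} (hc : 0 < c) : 0 < realCost qρ (fun _ => c) :=
  setIntegral_Ioo_pos (h.const_mem_finiteCost hc.le).2 fun t ht => mul_pos hc (h.kernel_pos t ht)

theorem aemeasurable_cost {Q : ℝ → ℝ} (hQ : Q ∈ nonnegQuantiles) :
    AEMeasurable (fun t => Q t * qρ (1 - t)) (volume.restrict (Ioo 0 1)) :=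
  (aemeasurable_of_mem_nonnegQuantiles hQ).mul h.kernel_int.aestronglyMeasurable.aemeasurable

theorem realCost_nonneg {Q : ℝ → ℝ} (hQ : Q ∈ nonnegQuantiles) : 0 ≤ realCost qρ Q :=
  setIntegral_nonneg measurableSet_Ioo fun t ht =>
    mul_nonneg (hQ.2.2 t ht) (h.kernel_pos t ht).le

theorem mem_finiteCost_of_cost_eq {Q : ℝ → ℝ} {x : ℝ} (hQ : Q ∈ nonnegQuantiles)
    (hc : cost qρ Q = (x : EReal)) : Q ∈ finiteCost qρ ∧ realCost qρ Q = x := by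
  have h1 : Q ∈ finiteCost qρ :=
    ⟨hQ, integrableOn_of_extIntegral_eq_coe (h.aemeasurable_cost hQ) hc⟩
  rw [cost_eq_realCost h1] at hc
  exact ⟨h1, by exact_mod_cast hc⟩

theorem mem_feasible_iff {Q : ℝ → ℝ} {x : ℝ} :
    Q ∈ feasible qρ x ↔ Q ∈ finiteCost qρ ∧ realCost qρ Q = x := by
  refine ⟨fun hQ => h.mem_finiteCost_of_cost_eq hQ.1 hQ.2, fun hQ => ⟨hQ.1.1, ?_⟩⟩
  rw [cost_eq_realCost hQ.1, hQ.2]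

theorem add_claim_mem {Q : ℝ → ℝ} (hQ : Q ∈ nonnegQuantiles) {t : ℝ} (ht : t ∈ Ioo (0 : ℝ) 1) :
    Q t + qϑ t ∈ Ici a := by
  have := hQ.2.2 t ht
  have := h.claim_ge t ht
  simp only [mem_Ici]
  linarith

theorem utility_monotoneOn {Q : ℝ → ℝ} (hQ : Q ∈ nonnegQuantiles) :
    MonotoneOn (fun t => u (Q t + qϑ t)) (Ioo 0 1) := fun _ hs _ ht hst =>
  h.utility.strictMonoOn.monotoneOn (h.add_claim_mem hQ hs) (h.add_claim_mem hQ ht)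
    (add_le_add (hQ.1 hs ht hst) (h.claim_mono hs ht hst))

theorem aemeasurable_utility {Q : ℝ → ℝ} (hQ : Q ∈ nonnegQuantiles) :
    AEMeasurable (fun t => u (Q t + qϑ t)) (volume.restrict (Ioo 0 1)) :=
  aemeasurable_restrict_of_monotoneOn measurableSet_Ioo (h.utility_monotoneOn hQ)

theorem utility_claim_le {Q : ℝ → ℝ} (hQ : Q ∈ nonnegQuantiles) {t : ℝ}
    (ht : t ∈ Ioo (0 : ℝ) 1) : u (qϑ t) ≤ u (Q t + qϑ t) :=
  h.utility.strictMonoOn.monotoneOn (h.claim_ge t ht) (h.add_claim_mem hQ ht)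
    (by linarith [hQ.2.2 t ht])

theorem integrableOn_utility_of_ne_top {Q : ℝ → ℝ} (hQ : Q ∈ nonnegQuantiles)
    (hfin : J₀ u qϑ Q ≠ ⊤) : IntegrableOn (fun t => u (Q t + qϑ t)) (Ioo 0 1) := by
  have h2 : ∫⁻ t in Ioo (0 : ℝ) 1, ENNReal.ofReal (-u (Q t + qϑ t)) ≠ ⊤ := by
    refine ne_top_of_le_ne_top h.utility_claim_int.neg.lintegral_lt_top.ne
      (setLIntegral_mono' measurableSet_Ioo fun t ht => ENNReal.ofReal_le_ofReal ?_)
    exact neg_le_neg (h.utility_claim_le hQ ht)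
  exact integrableOn_of_lintegral_ne_top (h.aemeasurable_utility hQ)
    (lintegral_pos_ne_top_of_extIntegral_ne_top hfin h2) h2

/-- The cost of `Q` may be zero, where `V₀` is not assumed finite. Adding `1` makes it positive, and
the utility of `Q` lies between those of the bare claim and of `Q + 1`. -/
theorem integrableOn_utility (hfin : ∀ y : ℝ, 0 < y → V₀ u qϑ qρ y < ⊤)
    {Q : ℝ → ℝ} (hQ : Q ∈ finiteCost qρ) :
    IntegrableOn (fun t => u (Q t + qϑ t)) (Ioo 0 1) := by
  have h1 := h.const_mem_finiteCost zero_le_one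
  have hR := finiteCost.add hQ h1
  have hpos : 0 < realCost qρ (fun t => Q t + 1) := by
    rw [realCost_add hQ h1]
    linarith [h.realCost_nonneg hQ.1, h.realCost_const_pos one_pos]
  have hne : J₀ u qϑ (fun t => Q t + 1) ≠ ⊤ := by
    refine (lt_of_le_of_lt ?_ (hfin _ hpos)).ne
    exact le_iSup₂ (f := fun R (_ : R ∈ feasible qρ _) => J₀ u qϑ R) _
      (h.mem_feasible_iff.2 ⟨hR, rfl⟩)
  refine integrableOn_Ioo_of_le (h.aemeasurable_utility hQ.1) h.utility_claim_int
    (h.integrableOn_utility_of_ne_top hR.1 hne) (fun t ht => h.utility_claim_le hQ.1 ht)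
    fun t ht => h.utility.strictMonoOn.monotoneOn (h.add_claim_mem hQ.1 ht)
      (h.add_claim_mem hR.1 ht) (by linarith)

/-! ### Utility and Lagrangian as real numbers -/

variable (hfin : ∀ y : ℝ, 0 < y → V₀ u qϑ qρ y < ⊤)
include hfin

theorem J₀_eq {Q : ℝ → ℝ} (hQ : Q ∈ finiteCost qρ) :
    J₀ u qϑ Q = (realUtility u qϑ Q : EReal) :=
  extIntegral_eq_integral (h.integrableOn_utility hfin hQ)

theorem integrableOn_lagrangian {Q : ℝ → ℝ} (hQ : Q ∈ finiteCost qρ) (lam : ℝ) :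
    IntegrableOn (fun t => u (Q t + qϑ t) - lam * Q t * qρ (1 - t)) (Ioo 0 1) := by
  simpa only [mul_assoc] using! (h.integrableOn_utility hfin hQ).sub (hQ.2.const_mul lam)

theorem integral_lagrangian {Q : ℝ → ℝ} (hQ : Q ∈ finiteCost qρ) (lam : ℝ) :
    ∫ t in Ioo (0 : ℝ) 1, (u (Q t + qϑ t) - lam * Q t * qρ (1 - t)) =
      realUtility u qϑ Q - lam * realCost qρ Q := by
  simp only [mul_assoc]
  rw [integral_sub (h.integrableOn_utility hfin hQ) (hQ.2.const_mul lam), integral_const_mul]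
  rfl

theorem Jlag_eq {Q : ℝ → ℝ} (hQ : Q ∈ finiteCost qρ) (lam : ℝ) :
    Jlag u qϑ qρ lam Q = ((realUtility u qϑ Q - lam * realCost qρ Q : ℝ) : EReal) := by
  rw [Jlag, extIntegral_eq_integral (h.integrableOn_lagrangian hfin hQ lam),
    h.integral_lagrangian hfin hQ]

theorem realUtility_lt_add_one {Q : ℝ → ℝ} (hQ : Q ∈ finiteCost qρ) :
    realUtility u qϑ Q < realUtility u qϑ (fun t => Q t + 1) := by
  have hR := finiteCost.add hQ (h.const_mem_finiteCost zero_le_one)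
  have h1 := h.integrableOn_utility hfin hQ
  have h2 := h.integrableOn_utility hfin hR
  have := setIntegral_Ioo_pos (h2.sub h1) fun t ht => sub_pos.2
    (h.utility.strictMonoOn (h.add_claim_mem hQ.1 ht) (h.add_claim_mem hR.1 ht) (by linarith))
  rw [integral_sub' h2 h1] at this
  exact sub_pos.1 this

theorem realUtility_concave {Q R : ℝ → ℝ} (hQ : Q ∈ finiteCost qρ) (hR : R ∈ finiteCost qρ)
    {p q : ℝ} (hp : 0 ≤ p) (hq : 0 ≤ q) (hpq : p + q = 1) :
    p * realUtility u qϑ Q + q * realUtility u qϑ R ≤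
      realUtility u qϑ (fun t => p * Q t + q * R t) := by
  have hS := finiteCost.add (finiteCost.const_mul hQ hp) (finiteCost.const_mul hR hq)
  have h1 := (h.integrableOn_utility hfin hQ).const_mul p
  have h2 := (h.integrableOn_utility hfin hR).const_mul q
  rw [realUtility, realUtility, ← integral_const_mul, ← integral_const_mul, ← integral_add h1 h2]
  refine setIntegral_mono_on (h1.add h2) (h.integrableOn_utility hfin hS) measurableSet_Ioo
    fun t ht => ?_
  have := h.utility.concaveOn.2 (h.add_claim_mem hQ.1 ht) (h.add_claim_mem hR.1 ht) hp hq hpq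
  simp only [smul_eq_mul] at this
  convert this using 2
  linear_combination (-qϑ t) * hpq

/-- A bound on the Lagrangian over the quantiles of finite cost extends to all quantiles. -/
theorem Jlag_le_of_forall_finiteCost {lam M : ℝ}
    (hM : ∀ Q ∈ finiteCost qρ, realUtility u qϑ Q - lam * realCost qρ Q ≤ M)
    {Q : ℝ → ℝ} (hQ : Q ∈ nonnegQuantiles) : Jlag u qϑ qρ lam Q ≤ (M : EReal) := by
  by_cases hbot : Jlag u qϑ qρ lam Q = ⊥
  · simp [hbot]
  set f : ℝ → ℝ := fun t => u (Q t + qϑ t) - lam * Q t * qρ (1 - t) with hf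
  have hfm : AEMeasurable f (volume.restrict (Ioo 0 1)) := by
    simpa only [hf, mul_assoc] using! (h.aemeasurable_utility hQ).sub
      ((h.aemeasurable_cost hQ).const_mul lam)
  have hneg : ∫⁻ t in Ioo (0 : ℝ) 1, ENNReal.ofReal (-f t) ≠ ⊤ :=
    lintegral_neg_ne_top_of_extIntegral_ne_bot hbot
  -- An integrable `b` with `-b` below every truncated Lagrangian `fn n`, as Fatou's lemma requires.
  set b : ℝ → ℝ := fun t => |u (qϑ t)| + max (-f t) 0 with hb
  have hbint : IntegrableOn b (Ioo 0 1) := by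
    refine h.utility_claim_int.abs.add
      (integrableOn_of_lintegral_ne_top (hfm.neg.max aemeasurable_const) ?_ ?_)
    · simpa [ENNReal.ofReal_max] using hneg
    · have h0 : ∀ t, ENNReal.ofReal (-max (-f t) 0) = 0 := fun t =>
        ENNReal.ofReal_of_nonpos (neg_nonpos.2 (le_max_right _ _))
      simp [h0]
  -- Bounded quantiles have finite cost because the kernel is integrable.
  set Qn : ℕ → ℝ → ℝ := fun n t => min (Q t) n with hQn
  have hQnm : ∀ n, Qn n ∈ finiteCost qρ := fun n => by
    have hm := nonnegQuantiles.min_const hQ n.cast_nonneg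
    refine ⟨hm, integrableOn_Ioo_of_le (h.aemeasurable_cost hm) (integrableOn_zero)
      (h.kernel_int.const_mul n) (fun t ht => ?_) fun t ht => ?_⟩
    · exact mul_nonneg (hm.2.2 t ht) (h.kernel_pos t ht).le
    · exact mul_le_mul_of_nonneg_right (min_le_right _ _) (h.kernel_pos t ht).le
  set fn : ℕ → ℝ → ℝ := fun n t => u (Qn n t + qϑ t) - lam * Qn n t * qρ (1 - t) with hfn
  have hfnint : ∀ n, IntegrableOn (fn n) (Ioo 0 1) := fun n =>
    h.integrableOn_lagrangian hfin (hQnm n) lam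
  have hfnb : ∀ n, ∀ t ∈ Ioo (0 : ℝ) 1, 0 ≤ fn n t + b t := by
    intro n t ht
    -- For fixed `t` the integrand is concave in the value of the quantile, so at `Qn n t`, between
    -- `0` and `Q t`, it is at least the smaller of its end values `u (qϑ t)` and `f t`.
    have hconc : ConcaveOn ℝ (Ici (0 : ℝ)) (fun z => u (z + qϑ t) - lam * z * qρ (1 - t)) := by
      refine ⟨convex_Ici 0, fun y hy z hz p q hp hq hpq => ?_⟩
      have hyz : ∀ w ∈ Ici (0 : ℝ), w + qϑ t ∈ Ici a := fun w hw => by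
        have := h.claim_ge t ht
        simp only [mem_Ici] at hw ⊢
        linarith
      have := h.utility.concaveOn.2 (hyz y hy) (hyz z hz) hp hq hpq
      simp only [smul_eq_mul] at this ⊢
      have e : p * y + q * z + qϑ t = p * (y + qϑ t) + q * (z + qϑ t) := by
        linear_combination (-qϑ t) * hpq
      rw [e]
      linarith
    have hmin := hconc.min_le_of_mem_Icc (x := 0) (y := Q t) (z := Qn n t) self_mem_Ici
      (hQ.2.2 t ht) ⟨(hQnm n).1.2.2 t ht, min_le_left _ _⟩
    simp only [zero_add, mul_zero, zero_mul, sub_zero] at hmin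
    have h1 := neg_abs_le (u (qϑ t))
    have h2 := le_max_left (-f t) 0
    have h3 := le_max_right (-f t) 0
    have h4 := abs_nonneg (u (qϑ t))
    rcases min_le_iff.1 hmin with h5 | h5 <;> simp only [hfn, hb] <;> simp only [hf] at * <;>
      linarith
  have hev : ∀ t, ∀ᶠ n in atTop, fn n t = f t := by
    intro t
    filter_upwards [eventually_ge_atTop ⌈Q t⌉₊] with n hn
    have : Qn n t = Q t := min_eq_left ((Nat.le_ceil _).trans (by exact_mod_cast hn))
    simp only [hfn, hf, this]
  have hlim : ∀ n, ∫⁻ t in Ioo (0 : ℝ) 1, ENNReal.ofReal (fn n t + b t) ≤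
      ENNReal.ofReal (M + ∫ t in Ioo (0 : ℝ) 1, b t) := by
    intro n
    rw [← ofReal_integral_eq_lintegral_ofReal (f := fun t => fn n t + b t) ((hfnint n).add hbint)
      ((ae_restrict_iff' measurableSet_Ioo).2 (ae_of_all _ (hfnb n)))]
    refine ENNReal.ofReal_le_ofReal ?_
    rw [integral_add (hfnint n) hbint, h.integral_lagrangian hfin (hQnm n)]
    linarith [hM _ (hQnm n)]
  have hfb : ∫⁻ t in Ioo (0 : ℝ) 1, ENNReal.ofReal (f t + b t) ≤
      ENNReal.ofReal (M + ∫ t in Ioo (0 : ℝ) 1, b t) := by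
    calc ∫⁻ t in Ioo (0 : ℝ) 1, ENNReal.ofReal (f t + b t)
        = ∫⁻ t in Ioo (0 : ℝ) 1, liminf (fun n => ENNReal.ofReal (fn n t + b t)) atTop := by
          refine lintegral_congr fun t => ?_
          have : Tendsto (fun n => ENNReal.ofReal (fn n t + b t)) atTop
              (𝓝 (ENNReal.ofReal (f t + b t))) :=
            tendsto_const_nhds.congr' (by
              filter_upwards [hev t] with n hn
              rw [hn])
          exact this.liminf_eq.symm
      _ ≤ liminf (fun n => ∫⁻ t in Ioo (0 : ℝ) 1, ENNReal.ofReal (fn n t + b t)) atTop :=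
          lintegral_liminf_le' fun n =>
            ((hfnint n).add hbint).aestronglyMeasurable.aemeasurable.ennreal_ofReal
      _ ≤ _ := liminf_le_of_le (by isBoundedDefault) fun c hc => by
          obtain ⟨n, hn⟩ := hc.exists
          exact hn.trans (hlim n)
  have hfint : IntegrableOn f (Ioo 0 1) := by
    refine integrableOn_of_lintegral_ne_top hfm
      (ne_top_of_le_ne_top ENNReal.ofReal_ne_top (le_trans (lintegral_mono fun t => ?_) hfb)) hneg
    refine ENNReal.ofReal_le_ofReal ?_
    have : 0 ≤ b t := add_nonneg (abs_nonneg _) (le_max_right _ _)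
    linarith
  have hfb0 : ∀ t ∈ Ioo (0 : ℝ) 1, 0 ≤ f t + b t := fun t ht => by
    obtain ⟨n, hn⟩ := (hev t).exists
    exact hn ▸ hfnb n t ht
  -- `ENNReal.ofReal` sends negatives to `0`, so a comparison under it can be undone only when the
  -- bound is nonnegative.
  have hMb : 0 ≤ M + ∫ t in Ioo (0 : ℝ) 1, b t := by
    have h1 := setIntegral_nonneg (μ := volume) measurableSet_Ioo (hfnb 0)
    rw [integral_add (hfnint 0) hbint, h.integral_lagrangian hfin (hQnm 0)] at h1
    linarith [hM _ (hQnm 0)]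
  rw [← ofReal_integral_eq_lintegral_ofReal (f := fun t => f t + b t) (hfint.add hbint)
    ((ae_restrict_iff' measurableSet_Ioo).2 (ae_of_all _ hfb0)),
    ENNReal.ofReal_le_ofReal_iff hMb, integral_add hfint hbint] at hfb
  rw [Jlag, extIntegral_eq_integral hfint]
  exact_mod_cast (add_le_add_iff_right _).1 hfb

/-- Existence of a Lagrange multiplier. -/
theorem exists_multiplier {Q : ℝ → ℝ} (hQ : Q ∈ finiteCost qρ) (hpos : 0 < realCost qρ Q)
    (hopt : ∀ R ∈ finiteCost qρ, realCost qρ R = realCost qρ Q →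
      realUtility u qϑ R ≤ realUtility u qϑ Q) :
    ∃ lam : ℝ, 0 < lam ∧ ∀ R ∈ finiteCost qρ,
      realUtility u qϑ R - lam * realCost qρ R ≤
        realUtility u qϑ Q - lam * realCost qρ Q := by
  -- `s R` is the slope of the chord from `Q` to `R` in the (cost, utility) plane.
  set x := realCost qρ Q with hx
  set s : (ℝ → ℝ) → ℝ := fun R => (realUtility u qϑ R - realUtility u qϑ Q) / (realCost qρ R - x)
    with hs
  have hsep : ∀ R ∈ finiteCost qρ, ∀ S ∈ finiteCost qρ, x < realCost qρ R → realCost qρ S < x →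
      s R ≤ s S := by
    intro R hR S hS hRx hSx
    have hd : 0 < realCost qρ R - realCost qρ S := by linarith
    -- Weights for which the mixture of `R` and `S` costs exactly `x`, so that optimality of `Q`
    -- applies to it.
    set p := (x - realCost qρ S) / (realCost qρ R - realCost qρ S) with hp
    set q := (realCost qρ R - x) / (realCost qρ R - realCost qρ S) with hq
    have hp0 : 0 ≤ p := div_nonneg (by linarith) hd.le
    have hq0 : 0 ≤ q := div_nonneg (by linarith) hd.le
    have hpq : p + q = 1 := by rw [hp, hq]; field_simp; ring
    have hpm := finiteCost.const_mul hR hp0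
    have hqm := finiteCost.const_mul hS hq0
    have hcost : realCost qρ (fun t => p * R t + q * S t) = x := by
      rw [realCost_add hpm hqm, realCost_const_mul, realCost_const_mul, hp, hq]
      field_simp
      ring
    have hle := (h.realUtility_concave hfin hR hS hp0 hq0 hpq).trans
      (hopt _ (finiteCost.add hpm hqm) hcost)
    have hle' : (x - realCost qρ S) * realUtility u qϑ R +
        (realCost qρ R - x) * realUtility u qϑ S ≤
        (realCost qρ R - realCost qρ S) * realUtility u qϑ Q := by
      have := mul_le_mul_of_nonneg_left hle hd.le
      have e1 : (realCost qρ R - realCost qρ S) * p = x - realCost qρ S := mul_div_cancel₀ _ hd.ne'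
      have e2 : (realCost qρ R - realCost qρ S) * q = realCost qρ R - x := mul_div_cancel₀ _ hd.ne'
      rwa [mul_add, ← mul_assoc, ← mul_assoc, e1, e2] at this
    simp only [hs]
    rw [← neg_div_neg_eq (realUtility u qϑ S - _), div_le_div_iff₀ (by linarith) (by linarith)]
    linarith
  have h0 := h.const_mem_finiteCost le_rfl
  have h1 := h.const_mem_finiteCost zero_le_one
  have h0x : realCost qρ (fun _ => 0) < x := by simpa [realCost] using hpos
  have hQ1 := finiteCost.add hQ h1
  have hQ1x : x < realCost qρ (fun t => Q t + 1) := by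
    rw [realCost_add hQ h1]
    linarith [h.realCost_const_pos one_pos]
  -- Any number separating the slopes to the right of `x` from those to the left will do; `Q + 1`
  -- and `0` show that both families are nonempty.
  obtain ⟨lam, hlam1, hlam2⟩ := exists_between_of_forall_le
    (s := s '' {R | R ∈ finiteCost qρ ∧ x < realCost qρ R})
    (t := s '' {R | R ∈ finiteCost qρ ∧ realCost qρ R < x})
    ⟨_, _, ⟨hQ1, hQ1x⟩, rfl⟩ ⟨_, _, ⟨h0, h0x⟩, rfl⟩ (by
      rintro _ ⟨R, hR, rfl⟩ _ ⟨S, hS, rfl⟩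
      exact hsep R hR.1 S hS.1 hR.2 hS.2)
  refine ⟨lam, ?_, fun R hR => ?_⟩
  · refine lt_of_lt_of_le ?_ (hlam1 ⟨_, ⟨hQ1, hQ1x⟩, rfl⟩)
    exact div_pos (sub_pos.2 (h.realUtility_lt_add_one hfin hQ)) (by linarith)
  · rcases lt_trichotomy (realCost qρ R) x with hRx | hRx | hRx
    · have := hlam2 ⟨R, ⟨hR, hRx⟩, rfl⟩
      simp only [hs] at this
      rw [le_div_iff_of_neg (by linarith)] at this
      linarith
    · rw [hRx]
      linarith [hopt R hR hRx]
    · have := hlam1 ⟨R, ⟨hR, hRx⟩, rfl⟩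
      simp only [hs] at this
      rw [div_le_iff₀ (by linarith)] at this
      linarith

/-! ### Equivalence of the two problems and of their values -/

theorem isOptimalConstrained_of_lagrangian {Q : ℝ → ℝ} {lam x : ℝ}
    (hc : cost qρ Q = (x : EReal)) (hopt : IsOptimalLagrangian u qϑ qρ lam Q) :
    IsOptimalConstrained u qϑ qρ x Q := by
  refine ⟨⟨hopt.1, hc⟩, fun R hR => ?_⟩
  obtain ⟨hQm, hQx⟩ := h.mem_finiteCost_of_cost_eq hopt.1 hc
  obtain ⟨hRm, hRx⟩ := h.mem_feasible_iff.1 hR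
  have := hopt.2 R hRm.1
  rw [h.Jlag_eq hfin hRm, h.Jlag_eq hfin hQm, EReal.coe_le_coe_iff, hQx, hRx] at this
  rw [h.J₀_eq hfin hRm, h.J₀_eq hfin hQm, EReal.coe_le_coe_iff]
  linarith

theorem exists_isOptimalLagrangian {Q : ℝ → ℝ} {x : ℝ} (hx : 0 < x)
    (hopt : IsOptimalConstrained u qϑ qρ x Q) :
    ∃ lam : ℝ, 0 < lam ∧ cost qρ Q = (x : EReal) ∧ IsOptimalLagrangian u qϑ qρ lam Q := by
  obtain ⟨hQm, hQx⟩ := h.mem_feasible_iff.1 hopt.1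
  obtain ⟨lam, hlam, hle⟩ := h.exists_multiplier hfin hQm (hQx ▸ hx) fun R hR hRQ => by
    have := hopt.2 R (h.mem_feasible_iff.2 ⟨hR, hRQ.trans hQx⟩)
    rwa [h.J₀_eq hfin hR, h.J₀_eq hfin hQm, EReal.coe_le_coe_iff] at this
  refine ⟨lam, hlam, hopt.1.2, hopt.1.1, fun R hR => ?_⟩
  rw [h.Jlag_eq hfin hQm]
  exact h.Jlag_le_of_forall_finiteCost hfin hle hR

theorem V₀_eq_Vlag_add {Q : ℝ → ℝ} {lam x : ℝ}
    (hc : cost qρ Q = (x : EReal)) (hopt : IsOptimalLagrangian u qϑ qρ lam Q) :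
    V₀ u qϑ qρ x = Vlag u qϑ qρ lam + ((lam * x : ℝ) : EReal) := by
  have hcon := h.isOptimalConstrained_of_lagrangian hfin hc hopt
  obtain ⟨hQm, hQx⟩ := h.mem_finiteCost_of_cost_eq hopt.1 hc
  have hV₀ : V₀ u qϑ qρ x = J₀ u qϑ Q :=
    le_antisymm (iSup₂_le hcon.2)
      (le_iSup₂ (f := fun R (_ : R ∈ feasible qρ x) => J₀ u qϑ R) Q hcon.1)
  have hVlag : Vlag u qϑ qρ lam = Jlag u qϑ qρ lam Q :=
    le_antisymm (iSup₂_le hopt.2)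
      (le_iSup₂ (f := fun R (_ : R ∈ nonnegQuantiles) => Jlag u qϑ qρ lam R) Q hopt.1)
  rw [hV₀, hVlag, h.J₀_eq hfin hQm, h.Jlag_eq hfin hQm, hQx, ← EReal.coe_add]
  congr 1
  ring

end IsMarket

/-- The quantiles of a claim and of a pricing kernel form a market on `(0,1)`. -/
theorem isMarket_quantile {Ω : Type*} [MeasurableSpace Ω] {P : Measure Ω}
    [IsProbabilityMeasure P] {ϑ ρ : Ω → ℝ} (hϑ : Measurable ϑ) (hρ : Measurable ρ)
    (hρ_pos : ∀ᵐ ω ∂P, 0 < ρ ω) (hρ_int : Integrable ρ P) {u : ℝ → ℝ} {a : ℝ}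
    (ha : ∀ᵐ ω ∂P, a ≤ ϑ ω) (hu : IsUtility u a)
    (huϑ : Integrable (fun ω => u (ϑ ω)) P) :
    IsMarket u (quantile P ϑ) (quantile P ρ) a where
  utility := hu
  claim_mono := quantile_monotoneOn hϑ
  claim_ge _ ht := le_quantile hϑ ha ht
  utility_claim_int := by
    refine integrableOn_comp_quantile hϑ ?_ huϑ
    -- `u` is controlled only on `[a, ∞)`, which carries the whole law of the claim.
    have hr : (P.map ϑ).restrict (Ici a) = P.map ϑ :=
      Measure.restrict_eq_self_of_ae_mem
        ((ae_map_iff hϑ.aemeasurable measurableSet_Ici).2 ha)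
    rw [← hr]
    exact hu.continuousOn.aestronglyMeasurable measurableSet_Ici
  kernel_pos t ht := quantile_pos hρ hρ_pos ⟨by linarith [ht.2], by linarith [ht.1]⟩
  kernel_int := IntegrableOn.comp_one_sub
    (integrableOn_comp_quantile (f := id) hρ aestronglyMeasurable_id hρ_int)

end RobustUtility
end

theorem mainTheorem9 {Ω : Type*} [MeasurableSpace Ω] (P : Measure Ω) [IsProbabilityMeasure P]
    (ϑ ρ : Ω → ℝ) (hϑ : Measurable ϑ) (hρ : Measurable ρ)
    -- the pricing kernel is positive with finite expectation
    (hρ_pos : ∀ᵐ ω ∂P, 0 < ρ ω) (hρ_int : Integrable ρ P)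
    -- the claim is almost surely bounded below
    (hϑ_bdd : ∃ c : ℝ, ∀ᵐ ω ∂P, c ≤ ϑ ω)
    (u : ℝ → ℝ) (hu : RobustUtility.IsUtility u (min 0 (essInf ϑ P)))
    (huϑ : Integrable (fun ω => u (ϑ ω)) P)
    -- the problem is well-posed: the value function is finite
    (hfin : ∀ y : ℝ, 0 < y →
      RobustUtility.V₀ u (RobustUtility.quantile P ϑ) (RobustUtility.quantile P ρ) y < ⊤)
    (x : ℝ) (hx : 0 < x) :
    (∀ Qbar : ℝ → ℝ,
      RobustUtility.IsOptimalConstrained u (RobustUtility.quantile P ϑ)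
          (RobustUtility.quantile P ρ) x Qbar ↔
        ∃ lam : ℝ, 0 < lam ∧
          RobustUtility.cost (RobustUtility.quantile P ρ) Qbar = (x : EReal) ∧
          RobustUtility.IsOptimalLagrangian u (RobustUtility.quantile P ϑ)
            (RobustUtility.quantile P ρ) lam Qbar) ∧
    (∀ (Qbar : ℝ → ℝ) (lam : ℝ), 0 < lam →
      RobustUtility.cost (RobustUtility.quantile P ρ) Qbar = (x : EReal) →
      RobustUtility.IsOptimalLagrangian u (RobustUtility.quantile P ϑ)
          (RobustUtility.quantile P ρ) lam Qbar →
        RobustUtility.V₀ u (RobustUtility.quantile P ϑ) (RobustUtility.quantile P ρ) x =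
          RobustUtility.Vlag u (RobustUtility.quantile P ϑ) (RobustUtility.quantile P ρ) lam
            + ((lam * x : ℝ) : EReal)) := by
  have hbb : IsBoundedUnder (· ≥ ·) (ae P) ϑ := hϑ_bdd
  have ha : ∀ᵐ ω ∂P, min 0 (essInf ϑ P) ≤ ϑ ω := by
    filter_upwards [ae_essInf_le hbb] with ω hω using (min_le_right _ _).trans hω
  have h := RobustUtility.isMarket_quantile hϑ hρ hρ_pos hρ_int ha hu huϑ
  refine ⟨fun Q => ⟨h.exists_isOptimalLagrangian hfin hx, ?_⟩,
    fun Q lam _ hc hopt => h.V₀_eq_Vlag_add hfin hc hopt⟩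
  rintro ⟨lam, -, hc, hopt⟩
  exact h.isOptimalConstrained_of_lagrangian hfin hc hopt
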